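/- **The gossip network.** Fix constants $\lambda_e,\lambda>0$. Let $G$ be a simple graph on $n$ vertices. A source updates itself at the points of a Poisson process of rate $\lambda_e$; each update increases the source's version counter by one. The source sends its current version to each vertex at rate $\lambda/n$, and each vertex $i$ sends its current version to each of its neighbours at rate $\lambda/\deg(i)$ (a vertex without neighbours sends nothing); all these Poisson processes are independent. A vertex that receives a version newer than its own adopts it. All counters agree at time $0$. Let $X_j(t)$ be the number of versions by which vertex $j$ is behind the source at time $t$. The version age of $j$ is $v_G(j)=\lim_{t\to\infty}\mathbb E[X_j(t)]$, and the average version age of $G$ is $\frac1n\sum_j v_G(j)$. These limits exist and are finite for every $G$, and an isolated vertex has version age exactly $\lambda_e n/\lambda$. **Random graphs.** $G(n,p)$ is the random graph on $n$ vertices in which each pair is an edge independently with probability $p$. A property holds a.a.s. if its probability tends to $1$ as $n\to\infty$. A function $p^*(n)$ is a threshold for a property $R$ if, for every $p=p(n)\in[0,1]$, $\mathbb P[G(n,p)\in R]\to 0$ whenever $p/p^*\to 0$, and $\mathbb P[G(n,p)\in R]\to 1$ whenever $p/p^*\to\infty$. **Theorem 3.** 1. Let $0<\epsilon\le 1$.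 If $p=\frac{(1-\epsilon)\log n}{n}$ (for all large $n$), then a.a.s. the average version age of $G(n,p)$ is $\Omega(n^{\epsilon})$: there is a constant $c>0$, depending only on $\epsilon,\lambda_e,\lambda$, such that a.a.s. it is at least $c\,n^{\epsilon}$. 2. Let $\epsilon>0$. If $p=\frac{(100+\epsilon)\log n}{n}$ (for all large $n$), then a.a.s. the average version age of $G(n,p)$ is $\Theta(\log n)$: there are constants $c,C>0$, depending only on $\epsilon,\lambda_e,\lambda$, such that a.a.s. it lies between $c\log n$ and $C\log n$. 3. There are constants $\alpha>0$ and $1\le c^*\le 100$ (depending only on $\lambda_e,\lambda$) such that $p^*=\frac{c^*\log n}{n}$ is a threshold for the property "$G$ has average version age less than $\alpha\log n$". -/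

import Mathlib

open MeasureTheory ProbabilityTheory Filter Topology
open scoped NNReal ENNReal

noncomputable section

namespace Gossip

/-- The clocks of the gossip network on the vertex set `Fin n`: the source's own update clock, the
clock by which the source sends to vertex `j`, and the clock by which vertex `i` sends to
vertex `j`. -/
inductive Clock (n : ℕ) : Type
  | update : Clock n
  | fromSource (j : Fin n) : Clock n
  | send (i j : Fin n) : Clock n
  deriving Fintype

/-- The rates of the independent Poisson clocks: the source updates itself at rate `lamE`, it sends
to each vertex at rate `lam / n`, and a vertex `i` sends to each of its neighbours at rate
`lam / deg i` (and to no other vertex). -/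
def rate (lamE lam : ℝ≥0) {n : ℕ} (G : SimpleGraph (Fin n)) : Clock n → ℝ≥0
  | .update => lamE
  | .fromSource _ => lam / n
  | .send i j => open Classical in if G.Adj i j then lam / G.degree i else 0

/-- A state `x` records the version age of every vertex: `x j` is the number of versions by which
the counter of `j` is behind the counter of the source. `ring a x` is the state right after clock
`a` rings in state `x`: an update of the source makes every vertex one version older, a vertex that
hears from the source becomes up to date, and a vertex `j` that hears from `i` keeps the newer of
the two versions. -/
def ring {n : ℕ} : Clock n → (Fin n → ℕ) → (Fin n → ℕ)
  | .update, x => fun k => x k + 1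
  | .fromSource j, x => Function.update x j 0
  | .send i j, x => Function.update x j (min (x j) (x i))

/-- The total rate of all the clocks. -/
def totalRate (lamE lam : ℝ≥0) {n : ℕ} (G : SimpleGraph (Fin n)) : ℝ≥0 :=
  ∑ a, rate lamE lam G a

/-- The law of the state after `k` rings, when all counters agree at the beginning: each ring is,
independently of the past, a ring of clock `a` with probability `rate a / totalRate`. -/
def jumpLaw (lamE lam : ℝ≥0) {n : ℕ} (G : SimpleGraph (Fin n)) : ℕ → Measure (Fin n → ℕ)
  | 0 => Measure.dirac 0
  | k + 1 => ∑ a, (rate lamE lam G a / totalRate lamE lam G) •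
      (jumpLaw lamE lam G k).map (ring a)

/-- The law at time `t` of the state `X(t) = (X_j(t))_j` of the gossip network, that is, of the
continuous-time Markov chain that starts at `0` and jumps from `x` to `ring a x` at rate `rate a`,
for each clock `a`. The superposition of the independent Poisson clocks is a Poisson process of rate
`totalRate`, so the number of rings up to time `t` is Poisson with mean `totalRate * t`, and it is
independent of the sequence of clocks that ring. -/
def law (lamE lam : ℝ≥0) {n : ℕ} (G : SimpleGraph (Fin n)) (t : ℝ≥0) : Measure (Fin n → ℕ) :=
  (poissonMeasure (totalRate lamE lam G * t)).bind (jumpLaw lamE lam G)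

/-- The mean `E[X_j(t)]` of the age of vertex `j` at time `t`. -/
def meanAge (lamE lam : ℝ≥0) {n : ℕ} (G : SimpleGraph (Fin n)) (j : Fin n) (t : ℝ≥0) : ℝ≥0∞ :=
  ∫⁻ x, (x j : ℝ≥0∞) ∂(law lamE lam G t)

/-- The version age of vertex `j`: the limiting mean age `lim_{t → ∞} E[X_j(t)]`. -/
def versionAge (lamE lam : ℝ≥0) {n : ℕ} (G : SimpleGraph (Fin n)) (j : Fin n) : ℝ :=
  (limUnder atTop (meanAge lamE lam G j)).toReal

/-- The average version age of a vertex of `G`. -/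
def averageVersionAge (lamE lam : ℝ≥0) {n : ℕ} (G : SimpleGraph (Fin n)) : ℝ :=
  (∑ j, versionAge lamE lam G j) / n

/-- The probability that `G(n, p)` has the property `Q`. -/
def gnpProb (n : ℕ) (p : unitInterval) (Q : SimpleGraph (Fin n) → Prop) : ℝ≥0∞ :=
  SimpleGraph.binomialRandom (Fin n) p {G | Q G}

/-- The property `Q` holds asymptotically almost surely in `G(n, p)`, where `p = p(n)`. -/
def AAS (p : ℕ → unitInterval) (Q : (n : ℕ) → SimpleGraph (Fin n) → Prop) : Prop :=
  Tendsto (fun n => gnpProb n (p n) (Q n)) atTop (𝓝 1)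

/-- `pstar` is a threshold for the property `Q` in `G(n, p)`: the probability of `Q` tends to `0`
whenever `p / pstar → 0`, and to `1` whenever `p / pstar → ∞`. -/
def IsThreshold (pstar : ℕ → ℝ) (Q : (n : ℕ) → SimpleGraph (Fin n) → Prop) : Prop :=
  ∀ p : ℕ → unitInterval,
    (Tendsto (fun n => (p n : ℝ) / pstar n) atTop (𝓝 0) →
      Tendsto (fun n => gnpProb n (p n) (Q n)) atTop (𝓝 0)) ∧
    (Tendsto (fun n => (p n : ℝ) / pstar n) atTop atTop →
      Tendsto (fun n => gnpProb n (p n) (Q n)) atTop (𝓝 1))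

end Gossip

end

noncomputable section

namespace Gossip

variable {n : ℕ}

/-! Single vertices do not satisfy a closed system, but sets do: for nonempty S let v(S) be the
limiting mean age of the most up-to-date vertex of S (`limitAge`). By duality (`minAge_ring`), a
message from i into S turns the minimum over S into the minimum over S ∪ {i}. This gives the
recursion `limitAge_eq`, |S| (λ/n) v(S) = λ_e + ∑ i, r_i(S) (v(S ∪ {i}) - v(S)), where r_i(S) is the
rate at which i sends to S. It is estimated by induction from large sets to small ones.

If the rate into S from outside is at least κ|S| for all S with at most half of the vertices, then v
drops by at most about λ_e/(κk) from sets of size k to sets of size k + 1, and a harmonic sum gives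
O(log n) (`limitAge_le_of_inRate_ge`). If that rate is at most of order |S|, the same comparison
gives a lower bound of order log n (`le_limitAge_of_inRate_le`).

For np ≥ 100 log n, Chernoff and union bounds (`measureReal_degree_expansion`) make all degrees at
most, and all small cuts per vertex at least, of order np, so both estimates apply. For np ≤ (1 - ε)
log n, the second moment method (`measureReal_isolatedCount_le`) yields order n^ε isolated vertices,
each of age λ_e n/λ. Both regimes need only inequalities for np, so the threshold follows from them.
-/

theorem sum_clock {M : Type*} [AddCommMonoid M] (g : Clock n → M) :
    ∑ a, g a = g .update + ∑ j, g (.fromSource j) + ∑ i, ∑ j, g (.send i j) := by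
  let e : Unit ⊕ Fin n ⊕ (Fin n × Fin n) ≃ Clock n :=
    { toFun := fun
        | .inl _ => .update
        | .inr (.inl j) => .fromSource j
        | .inr (.inr (i, j)) => .send i j
      invFun := fun
        | .update => .inl ()
        | .fromSource j => .inr (.inl j)
        | .send i j => .inr (.inr (i, j))
      left_inv := by rintro (_ | _ | ⟨_, _⟩) <;> rfl
      right_inv := by rintro (_ | _ | _) <;> rfl }
  rw [← e.sum_comp]
  simp [e, Fintype.sum_sum_type, Fintype.sum_prod_type, add_assoc]

/-! ### Duality and the recursion for the jump chain -/

/-- The age of the most up-to-date vertex of `S`. -/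
def minAge (S : Finset (Fin n)) (x : Fin n → ℕ) : ℝ≥0∞ := S.inf fun j => (x j : ℝ≥0∞)

/-- The effect of a ring of clock `a` on a functional of sets of vertices, seen backwards in
time. -/
def dualRing (φ : Finset (Fin n) → ℝ≥0∞) (S : Finset (Fin n)) : Clock n → ℝ≥0∞
  | .update => φ S + 1
  | .fromSource j => if j ∈ S then 0 else φ S
  | .send i j => if j ∈ S then φ (insert i S) else φ S

theorem minAge_update_of_notMem {S : Finset (Fin n)} {j : Fin n} (hj : j ∉ S) (x : Fin n → ℕ)
    (c : ℕ) : minAge S (Function.update x j c) = minAge S x := by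
  refine Finset.inf_congr rfl fun i hi => ?_
  rw [Function.update_of_ne (by rintro rfl; exact hj hi)]

/-- If j ∈ S takes the minimum of its own age and that of i, the minimum over S afterwards is the
minimum over `insert i S` before. This makes the system of the means of `minAge` closed under rings.
-/
theorem minAge_ring {S : Finset (Fin n)} (a : Clock n) (x : Fin n → ℕ) :
    minAge S (ring a x) = dualRing (fun T => minAge T x) S a := by
  cases a with
  | update =>
    simp only [minAge, ring, dualRing, Nat.cast_add, Nat.cast_one]
    induction S using Finset.induction_on with
    | empty => simp
    | insert a s _ ih => rw [Finset.inf_insert, Finset.inf_insert, ih, min_add_add_right]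
  | fromSource j =>
    simp only [ring, dualRing]
    split_ifs with hj
    · refine le_antisymm ((Finset.inf_le hj).trans (by simp)) (by simp)
    · exact minAge_update_of_notMem hj x 0
  | send i j =>
    simp only [ring, dualRing]
    split_ifs with hj
    · simp only [minAge]
      apply le_antisymm
      · refine Finset.le_inf fun k hk => ?_
        rcases Finset.mem_insert.1 hk with rfl | hk
        · exact (Finset.inf_le hj).trans (by simp)
        · refine (Finset.inf_le hk).trans ?_
          rcases eq_or_ne k j with rfl | h
          · simp
          · simp [Function.update_of_ne h]
      · refine Finset.le_inf fun k hk => ?_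
        rcases eq_or_ne k j with rfl | h
        · rw [Function.update_self]
          rcases min_choice (x k) (x i) with h | h <;> rw [h]
          · exact Finset.inf_le (f := fun j => (x j : ℝ≥0∞)) (Finset.mem_insert_of_mem hk)
          · exact Finset.inf_le (f := fun j => (x j : ℝ≥0∞)) (Finset.mem_insert_self _ _)
        · rw [Function.update_of_ne h]
          exact Finset.inf_le (Finset.mem_insert_of_mem hk)
    · exact minAge_update_of_notMem hj x _

variable (lamE lam : ℝ≥0) (G : SimpleGraph (Fin n))

/-- The mean of `minAge S` after `k` rings. -/
def meanMinAge (k : ℕ) (S : Finset (Fin n)) : ℝ≥0∞ := ∫⁻ x, minAge S x ∂jumpLaw lamE lam G k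

variable {lamE lam}

theorem totalRate_pos (hlamE : 0 < lamE) : 0 < totalRate lamE lam G := by
  rw [totalRate, sum_clock]
  have : 0 < rate lamE lam G .update := hlamE
  positivity

theorem isProbabilityMeasure_jumpLaw (hlamE : 0 < lamE) (k : ℕ) :
    IsProbabilityMeasure (jumpLaw lamE lam G k) := by
  induction k with
  | zero => rw [jumpLaw]; infer_instance
  | succ k ih =>
    constructor
    simp only [jumpLaw, Measure.finsetSum_apply, Measure.smul_apply]
    have h : ∀ a : Clock n, (jumpLaw lamE lam G k).map (ring a) Set.univ = 1 := fun a => by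
      rw [Measure.map_apply (measurable_of_countable _) MeasurableSet.univ]; simp
    simp only [h, ENNReal.smul_def, smul_eq_mul, mul_one]
    rw [← ENNReal.ofNNReal_finsetSum, ← Finset.sum_div, ← totalRate,
      div_self (totalRate_pos G hlamE).ne', ENNReal.coe_one]

/-- Nonemptiness matters here and below: the minimum over the empty set is `∞`. -/
theorem meanMinAge_zero {S : Finset (Fin n)} (hS : S.Nonempty) :
    meanMinAge lamE lam G 0 S = 0 := by
  obtain ⟨j, hj⟩ := hS
  rw [meanMinAge, jumpLaw, lintegral_dirac]
  exact le_antisymm ((Finset.inf_le hj).trans (by simp)) (by simp)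

theorem meanMinAge_succ (hlamE : 0 < lamE) (k : ℕ) (S : Finset (Fin n)) :
    meanMinAge lamE lam G (k + 1) S = ∑ a, ((rate lamE lam G a / totalRate lamE lam G : ℝ≥0) : ℝ≥0∞)
      * dualRing (meanMinAge lamE lam G k) S a := by
  have := isProbabilityMeasure_jumpLaw (lam := lam) G hlamE k
  simp only [meanMinAge, jumpLaw]
  rw [lintegral_finsetSum_measure]
  refine Finset.sum_congr rfl fun a _ => ?_
  rw [lintegral_smul_measure, ENNReal.smul_def, smul_eq_mul,
    lintegral_map (measurable_of_countable _) (measurable_of_countable _)]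
  congr 1
  simp only [minAge_ring]
  cases a with
  | update =>
    simp only [dualRing]
    rw [lintegral_add_right _ measurable_const]
    simp [meanMinAge]
  | fromSource j =>
    simp only [dualRing]
    split_ifs <;> simp [meanMinAge]
  | send i j =>
    simp only [dualRing]
    split_ifs <;> simp [meanMinAge]

theorem dualRing_mono {φ ψ : Finset (Fin n) → ℝ≥0∞} {S : Finset (Fin n)} (hS : S.Nonempty)
    (h : ∀ T : Finset (Fin n), T.Nonempty → φ T ≤ ψ T) (a : Clock n) :
    dualRing φ S a ≤ dualRing ψ S a := by
  cases a with
  | update => exact add_le_add_left (h S hS) 1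
  | fromSource j => simp only [dualRing]; split_ifs; exacts [le_rfl, h S hS]
  | send i j => simp only [dualRing]; split_ifs; exacts [h _ (Finset.insert_nonempty _ _), h S hS]

/-- The recursion is monotone in its input and the sequence starts at its least value `0`, so one
comparison propagates through all steps. -/
theorem meanMinAge_le_succ (hlamE : 0 < lamE) (k : ℕ) {S : Finset (Fin n)} (hS : S.Nonempty) :
    meanMinAge lamE lam G k S ≤ meanMinAge lamE lam G (k + 1) S := by
  induction k generalizing S with
  | zero => rw [meanMinAge_zero G hS]; exact zero_le
  | succ k ih =>
    rw [meanMinAge_succ G hlamE, meanMinAge_succ G hlamE]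
    exact Finset.sum_le_sum fun a _ => mul_le_mul_right (dualRing_mono hS (fun T => ih) a) _

theorem monotone_meanMinAge (hlamE : 0 < lamE) {S : Finset (Fin n)} (hS : S.Nonempty) :
    Monotone fun k => meanMinAge lamE lam G k S :=
  monotone_nat_of_le_succ fun k => meanMinAge_le_succ G hlamE k hS

theorem meanMinAge_anti (k : ℕ) {S T : Finset (Fin n)} (h : S ⊆ T) :
    meanMinAge lamE lam G k T ≤ meanMinAge lamE lam G k S :=
  lintegral_mono fun _ => Finset.inf_mono h

/-- The rate at which vertex `i` sends to the set `S`. -/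
def inRate (lam : ℝ≥0) (G : SimpleGraph (Fin n)) (S : Finset (Fin n)) (i : Fin n) : ℝ≥0 :=
  -- The update rate does not enter the rates of the `send` clocks, so any value, here `0`, will do.
  ∑ j ∈ S, rate 0 lam G (.send i j)

theorem sum_rate_mul_dualRing (φ : Finset (Fin n) → ℝ≥0∞) (S : Finset (Fin n)) :
    ∑ a, (rate lamE lam G a : ℝ≥0∞) * dualRing φ S a =
      lamE * (φ S + 1) + ((Sᶜ.card : ℝ≥0) * (lam / n) : ℝ≥0) * φ S +
      ∑ i, (inRate lam G S i * φ (insert i S) + inRate lam G Sᶜ i * φ S) := by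
  rw [sum_clock]
  congr 1
  · congr 1
    simp only [dualRing, rate, mul_ite, mul_zero]
    rw [Finset.sum_ite]
    simp only [Finset.sum_const_zero, zero_add, Finset.sum_const, nsmul_eq_mul, ENNReal.coe_mul,
      ENNReal.coe_natCast, mul_assoc]
    congr 3
    ext; simp
  · refine Finset.sum_congr rfl fun i _ => ?_
    simp only [dualRing, mul_ite]
    rw [Finset.sum_ite, ← Finset.sum_mul, ← Finset.sum_mul]
    have h1 : Finset.univ.filter (· ∈ S) = S := by ext; simp
    have h2 : Finset.univ.filter (· ∉ S) = Sᶜ := by ext; simp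
    rw [h1, h2, inRate, inRate]
    push_cast
    rfl

/-- The same splitting of the clocks by target in S or outside S as in `sum_rate_mul_dualRing`, so
that the terms that leave S unchanged cancel in `limitAge_eq`. -/
theorem totalRate_eq (S : Finset (Fin n)) :
    totalRate lamE lam G = lamE + (Sᶜ.card + S.card) * (lam / n) +
      ∑ i, (inRate lam G S i + inRate lam G Sᶜ i) := by
  rw [totalRate, sum_clock]
  congr 1
  · congr 1
    simp only [rate, Finset.sum_const, Finset.card_univ, Fintype.card_fin, nsmul_eq_mul]
    rw [← Nat.cast_add, Finset.card_compl_add_card, Fintype.card_fin]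
  · refine Finset.sum_congr rfl fun i _ => ?_
    rw [inRate, inRate, Finset.sum_add_sum_compl]
    rfl

theorem totalRate_mul_meanMinAge_succ (hlamE : 0 < lamE) (k : ℕ) (S : Finset (Fin n)) :
    totalRate lamE lam G * meanMinAge lamE lam G (k + 1) S =
      lamE * (meanMinAge lamE lam G k S + 1) +
      ((Sᶜ.card : ℝ≥0) * (lam / n) : ℝ≥0) * meanMinAge lamE lam G k S +
      ∑ i, (inRate lam G S i * meanMinAge lamE lam G k (insert i S) +
        inRate lam G Sᶜ i * meanMinAge lamE lam G k S) := by
  rw [← sum_rate_mul_dualRing, meanMinAge_succ G hlamE, Finset.mul_sum]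
  refine Finset.sum_congr rfl fun a _ => ?_
  rw [← mul_assoc, ← ENNReal.coe_mul, mul_div_cancel₀ _ (totalRate_pos G hlamE).ne']

/-- The constant λ_e n/λ is a supersolution of the recursion: a nonempty set hears from the source
at rate at least λ/n, which offsets the update rate λ_e. -/
theorem meanMinAge_le (hlamE : 0 < lamE) (hlam : 0 < lam) (k : ℕ) {S : Finset (Fin n)}
    (hS : S.Nonempty) : meanMinAge lamE lam G k S ≤ (lamE * n / lam : ℝ≥0) := by
  induction k generalizing S with
  | zero => rw [meanMinAge_zero G hS]; exact zero_le
  | succ k ih =>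
    have hΛ := totalRate_pos (lam := lam) G hlamE
    have hn : (0 : ℝ≥0) < n := by
      obtain ⟨j, -⟩ := hS
      exact_mod_cast j.pos
    have hc : (1 : ℝ≥0) ≤ S.card := by exact_mod_cast hS.card_pos
    set B : ℝ≥0 := lamE * n / lam
    have hB : lamE = lam / n * B := by simp only [B]; field_simp
    have h : (totalRate lamE lam G : ℝ≥0∞) * meanMinAge lamE lam G (k + 1) S ≤
        totalRate lamE lam G * B := by
      rw [totalRate_mul_meanMinAge_succ G hlamE]
      calc _ ≤ (lamE : ℝ≥0∞) * (B + 1) + ((Sᶜ.card : ℝ≥0) * (lam / n) : ℝ≥0) * B +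
            ∑ i, ((inRate lam G S i : ℝ≥0∞) * B + inRate lam G Sᶜ i * B) := by
              gcongr
              exacts [ih hS, ih hS, ih (Finset.insert_nonempty _ _), ih hS]
        _ ≤ _ := by
          rw [totalRate_eq G S]
          norm_cast
          have h1 : lamE ≤ S.card * (lam / n) * B := by
            rw [mul_assoc, ← hB]
            exact le_mul_of_one_le_left zero_le hc
          have h2 : ∑ i, (inRate lam G S i * B + inRate lam G Sᶜ i * B) =
              (∑ i, (inRate lam G S i + inRate lam G Sᶜ i)) * B := by
            simp only [Finset.sum_mul, add_mul]
          rw [h2]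
          calc _ = (lamE * B + Sᶜ.card * (lam / n) * B +
                (∑ i, (inRate lam G S i + inRate lam G Sᶜ i)) * B) + lamE := by ring
            _ ≤ (lamE * B + Sᶜ.card * (lam / n) * B +
                (∑ i, (inRate lam G S i + inRate lam G Sᶜ i)) * B) +
                S.card * (lam / n) * B := by gcongr
            _ = _ := by push_cast; ring
    rwa [ENNReal.mul_le_mul_iff_right (by exact_mod_cast hΛ.ne') ENNReal.coe_ne_top] at h

/-! ### From the jump chain to continuous time, and the limiting recursion -/

theorem tendsto_poissonMeasure_Iio (K : ℕ) :
    Tendsto (fun r : ℝ≥0 => poissonMeasure r (Set.Iio K)) atTop (𝓝 0) := by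
  have h : ∀ r : ℝ≥0, poissonMeasure r (Set.Iio K) =
      ∑ k ∈ Finset.range K, ENNReal.ofReal (Real.exp (-r) * r ^ k / k.factorial) := fun r => by
    rw [← Finset.coe_range, ← sum_measure_singleton]
    exact Finset.sum_congr rfl fun k _ => poissonMeasure_singleton r k
  simp only [h]
  rw [← Finset.sum_const_zero (s := Finset.range K)]
  refine tendsto_finsetSum _ fun k _ => ?_
  rw [← ENNReal.ofReal_zero]
  refine ENNReal.tendsto_ofReal ?_
  have h1 := ((Real.tendsto_pow_mul_exp_neg_atTop_nhds_zero k).comp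
    (NNReal.tendsto_coe_atTop.2 tendsto_id)).div_const (k.factorial : ℝ)
  simpa [mul_comm, Function.comp_def] using h1

/-- The mean of an increasing function of a Poisson variable tends to its supremum as the rate
tends to infinity. -/
theorem tendsto_lintegral_poissonMeasure {F : ℕ → ℝ≥0∞} (hF : Monotone F) :
    Tendsto (fun r : ℝ≥0 => ∫⁻ k, F k ∂poissonMeasure r) atTop (𝓝 (⨆ k, F k)) := by
  have hup : ∀ r : ℝ≥0, ∫⁻ k, F k ∂poissonMeasure r ≤ ⨆ k, F k := fun r =>
    (lintegral_mono fun k => le_iSup F k).trans (by simp)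
  refine tendsto_order.2 ⟨fun a ha => ?_, fun a ha => Eventually.of_forall fun r =>
    (hup r).trans_lt ha⟩
  obtain ⟨K, hK⟩ := lt_iSup_iff.1 ha
  -- Keeping only k ≥ K bounds the mean below by `F K` times a probability that tends to 1.
  have hlim : Tendsto (fun r : ℝ≥0 => F K * (1 - poissonMeasure r (Set.Iio K))) atTop
      (𝓝 (F K * (1 - 0))) := by
    refine ENNReal.Tendsto.const_mul ?_ (Or.inl (by simp))
    exact ENNReal.Tendsto.sub tendsto_const_nhds (tendsto_poissonMeasure_Iio K) (by simp)
  rw [tsub_zero, mul_one] at hlim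
  filter_upwards [hlim.eventually (lt_mem_nhds hK)] with r hr
  refine hr.trans_le ?_
  have hc : 1 - poissonMeasure r (Set.Iio K) = poissonMeasure r (Set.Ici K) := by
    rw [← Set.compl_Iio, prob_compl_eq_one_sub (Set.to_countable _).measurableSet]
  rw [hc, ← setLIntegral_const]
  refine (setLIntegral_mono' (Set.to_countable _).measurableSet fun k hk => hF hk).trans ?_
  exact setLIntegral_le_lintegral _ _

/-- The limiting mean age of the most up-to-date vertex of `S`. -/
def limitAge (lamE lam : ℝ≥0) (G : SimpleGraph (Fin n)) (S : Finset (Fin n)) : ℝ :=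
  (⨆ k, meanMinAge lamE lam G k S).toReal

theorem iSup_meanMinAge_ne_top (hlamE : 0 < lamE) (hlam : 0 < lam) {S : Finset (Fin n)}
    (hS : S.Nonempty) : ⨆ k, meanMinAge lamE lam G k S ≠ ∞ :=
  ((iSup_le fun k => meanMinAge_le G hlamE hlam k hS).trans_lt ENNReal.coe_lt_top).ne

theorem meanAge_eq (j : Fin n) (t : ℝ≥0) :
    meanAge lamE lam G j t =
      ∫⁻ k, meanMinAge lamE lam G k {j} ∂poissonMeasure (totalRate lamE lam G * t) := by
  rw [meanAge, law, Measure.lintegral_bind (measurable_of_countable _).aemeasurable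
    (measurable_of_countable _).aemeasurable]
  simp [meanMinAge, minAge]

/-- The number of rings up to time t is Poisson with mean tending to infinity, and the mean age
increases with the number of rings; so the limit is the supremum along the jump chain. -/
theorem tendsto_meanAge (hlamE : 0 < lamE) (j : Fin n) :
    Tendsto (meanAge lamE lam G j) atTop (𝓝 (⨆ k, meanMinAge lamE lam G k {j})) := by
  have h := tendsto_lintegral_poissonMeasure
    (monotone_meanMinAge (lam := lam) G hlamE (Finset.singleton_nonempty j))
  have h2 : Tendsto (fun t : ℝ≥0 => totalRate lamE lam G * t) atTop atTop := by
    rw [← NNReal.tendsto_coe_atTop]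
    push_cast
    exact (NNReal.tendsto_coe_atTop.2 tendsto_id).const_mul_atTop
      (NNReal.coe_pos.2 (totalRate_pos G hlamE))
  exact (h.comp h2).congr fun t => (meanAge_eq G j t).symm

theorem versionAge_eq_limitAge (hlamE : 0 < lamE) (j : Fin n) :
    versionAge lamE lam G j = limitAge lamE lam G {j} := by
  rw [versionAge, limitAge, (tendsto_meanAge G hlamE j).limUnder_eq]

theorem tendsto_meanAge_versionAge (hlamE : 0 < lamE) (hlam : 0 < lam) (j : Fin n) :
    Tendsto (meanAge lamE lam G j) atTop (𝓝 (ENNReal.ofReal (versionAge lamE lam G j))) := by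
  rw [versionAge_eq_limitAge G hlamE, limitAge,
    ENNReal.ofReal_toReal (iSup_meanMinAge_ne_top G hlamE hlam (Finset.singleton_nonempty j))]
  exact tendsto_meanAge G hlamE j

theorem limitAge_nonneg (S : Finset (Fin n)) : 0 ≤ limitAge lamE lam G S := ENNReal.toReal_nonneg

theorem limitAge_anti (hlamE : 0 < lamE) (hlam : 0 < lam) {S T : Finset (Fin n)}
    (hS : S.Nonempty) (h : S ⊆ T) : limitAge lamE lam G T ≤ limitAge lamE lam G S :=
  ENNReal.toReal_mono (iSup_meanMinAge_ne_top G hlamE hlam hS)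
    (iSup_mono fun k => meanMinAge_anti G k h)

theorem tendsto_meanMinAge (hlamE : 0 < lamE) {S : Finset (Fin n)} (hS : S.Nonempty) :
    Tendsto (fun k => meanMinAge lamE lam G k S) atTop (𝓝 (⨆ k, meanMinAge lamE lam G k S)) :=
  tendsto_atTop_iSup (monotone_meanMinAge G hlamE hS)

theorem tendsto_toReal_meanMinAge (hlamE : 0 < lamE) (hlam : 0 < lam) {S : Finset (Fin n)}
    (hS : S.Nonempty) : Tendsto (fun k => (meanMinAge lamE lam G k S).toReal) atTop
      (𝓝 (limitAge lamE lam G S)) :=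
  (ENNReal.tendsto_toReal (iSup_meanMinAge_ne_top G hlamE hlam hS)).comp
    (tendsto_meanMinAge G hlamE hS)

theorem totalRate_mul_toReal_meanMinAge_succ (hlamE : 0 < lamE) (hlam : 0 < lam) (k : ℕ)
    {S : Finset (Fin n)} (hS : S.Nonempty) :
    totalRate lamE lam G * (meanMinAge lamE lam G (k + 1) S).toReal =
      lamE * ((meanMinAge lamE lam G k S).toReal + 1) +
      (Sᶜ.card : ℝ) * (lam / n) * (meanMinAge lamE lam G k S).toReal +
      ∑ i, (inRate lam G S i * (meanMinAge lamE lam G k (insert i S)).toReal +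
        inRate lam G Sᶜ i * (meanMinAge lamE lam G k S).toReal) := by
  obtain ⟨f, hf⟩ : ∃ f : Finset (Fin n) → ℝ≥0, ∀ T : Finset (Fin n), T.Nonempty →
      meanMinAge lamE lam G k T = f T := ⟨fun T => (meanMinAge lamE lam G k T).toNNReal,
    fun T hT => (ENNReal.coe_toNNReal
      ((meanMinAge_le G hlamE hlam k hT).trans_lt ENNReal.coe_lt_top).ne).symm⟩
  have h := congrArg ENNReal.toReal (totalRate_mul_meanMinAge_succ (lam := lam) G hlamE k S)
  rw [ENNReal.toReal_mul, ENNReal.coe_toReal] at h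
  rw [h]
  simp only [hf S hS, hf _ (Finset.insert_nonempty _ S), ENNReal.coe_toReal]
  norm_cast

/-- The recursion for the limiting mean ages of sets of vertices. -/
theorem limitAge_eq (hlamE : 0 < lamE) (hlam : 0 < lam) {S : Finset (Fin n)} (hS : S.Nonempty) :
    (S.card : ℝ) * (lam / n) * limitAge lamE lam G S = lamE +
      ∑ i, inRate lam G S i * (limitAge lamE lam G (insert i S) - limitAge lamE lam G S) := by
  have ht := tendsto_toReal_meanMinAge G hlamE hlam hS
  have hl := (ht.comp (tendsto_add_atTop_nat 1)).const_mul (totalRate lamE lam G : ℝ)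
  have hr : Tendsto (fun k => lamE * ((meanMinAge lamE lam G k S).toReal + 1) +
      (Sᶜ.card : ℝ) * (lam / n) * (meanMinAge lamE lam G k S).toReal +
      ∑ i, (inRate lam G S i * (meanMinAge lamE lam G k (insert i S)).toReal +
        inRate lam G Sᶜ i * (meanMinAge lamE lam G k S).toReal)) atTop
      (𝓝 (lamE * (limitAge lamE lam G S + 1) +
      (Sᶜ.card : ℝ) * (lam / n) * limitAge lamE lam G S +
      ∑ i, (inRate lam G S i * limitAge lamE lam G (insert i S) +
        inRate lam G Sᶜ i * limitAge lamE lam G S))) := by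
    refine ((((ht.add_const 1).const_mul _).add (ht.const_mul _)).add
      (tendsto_finsetSum _ fun i _ => ?_))
    exact ((tendsto_toReal_meanMinAge G hlamE hlam (Finset.insert_nonempty i S)).const_mul _).add
      (ht.const_mul _)
  have heq := tendsto_nhds_unique (hl.congr fun k =>
    totalRate_mul_toReal_meanMinAge_succ G hlamE hlam k hS) hr
  have hΛ : (totalRate lamE lam G : ℝ) = lamE + (Sᶜ.card + S.card) * (lam / n) +
      ∑ i, ((inRate lam G S i : ℝ) + inRate lam G Sᶜ i) := by
    rw [totalRate_eq G S]; push_cast; rfl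
  rw [hΛ] at heq
  simp only [Finset.sum_add_distrib, ← Finset.sum_mul, mul_sub, Finset.sum_sub_distrib] at heq ⊢
  linarith

/-- No vertex sends to j, so the recursion for {j} reduces to (λ/n) v = λ_e. -/
theorem versionAge_of_isolated (hlamE : 0 < lamE) (hlam : 0 < lam) {j : Fin n}
    (hj : ∀ i, ¬ G.Adj j i) : versionAge lamE lam G j = (lamE : ℝ) * n / lam := by
  rw [versionAge_eq_limitAge G hlamE]
  have h := limitAge_eq (lamE := lamE) G hlamE hlam (Finset.singleton_nonempty j)
  have h0 : ∀ i, inRate lam G {j} i = 0 := fun i => by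
    simp [inRate, rate, G.adj_comm i j, hj i]
  simp only [h0, NNReal.coe_zero, zero_mul, Finset.sum_const_zero, add_zero,
    Finset.card_singleton, Nat.cast_one, one_mul] at h
  have hn : (0 : ℝ) < n := by exact_mod_cast j.pos
  have hl : (0 : ℝ) < lam := hlam
  rw [eq_div_iff hl.ne', ← h]
  field_simp

/-! ### From spreading rates to version ages -/

theorem sum_inRate_mul (lam : ℝ≥0) (S : Finset (Fin n)) (f : Finset (Fin n) → ℝ) :
    ∑ i, inRate lam G S i * (f (insert i S) - f S) =
      ∑ i ∈ Sᶜ, inRate lam G S i * (f (insert i S) - f S) := by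
  symm
  refine Finset.sum_subset (Finset.subset_univ _) fun i _ hi => ?_
  rw [Finset.insert_eq_of_mem (by simpa using hi), sub_self, mul_zero]

/-- An upper bound for the version ages in a network where information spreads fast into small
sets. -/
theorem limitAge_le_of_inRate_ge (hlamE : 0 < lamE) (hlam : 0 < lam) {κ : ℝ} (hκ : 0 < κ)
    (h : ∀ S : Finset (Fin n), S.Nonempty → 2 * S.card ≤ n →
      κ * S.card ≤ ∑ i ∈ Sᶜ, (inRate lam G S i : ℝ)) (m : ℕ) {S : Finset (Fin n)}
    (hS : S.Nonempty) (hm : S.card + m = n) :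
    limitAge lamE lam G S ≤ 2 * lamE / lam +
      lamE / κ * ∑ k ∈ Finset.Ico S.card n, (k : ℝ)⁻¹ := by
  have hl : (0 : ℝ) < lam := hlam
  have hlE : (0 : ℝ) < lamE := hlamE
  have hc : (0 : ℝ) < S.card := by exact_mod_cast hS.card_pos
  have hn : (0 : ℝ) < n := by
    have := hS.card_pos
    exact_mod_cast (by omega : 0 < n)
  have hsum0 : 0 ≤ ∑ k ∈ Finset.Ico S.card n, (k : ℝ)⁻¹ :=
    Finset.sum_nonneg fun k _ => by positivity
  have heq := limitAge_eq G hlamE hlam hS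
  rw [sum_inRate_mul] at heq
  by_cases hbig : 2 * S.card ≤ n
  · obtain _ | m := m
    · have := hS.card_pos; omega
    -- If v(S) exceeded the bound, the induction hypothesis for `insert i S`, whose harmonic sum
    -- lacks the term 1/|S|, would make every increment at most -λ_e/(κ|S|). The weights total at
    -- least κ|S|, so the right side of the recursion would be at most 0, while the left side is
    -- positive.
    by_contra! hlt
    have hdiff : ∀ i ∈ Sᶜ, limitAge lamE lam G (insert i S) - limitAge lamE lam G S ≤
        -(lamE / κ * (S.card : ℝ)⁻¹) := fun i hi => by
      have hcard := Finset.card_insert_of_notMem (Finset.mem_compl.1 hi)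
      have := limitAge_le_of_inRate_ge hlamE hlam hκ h m (Finset.insert_nonempty i S) (by omega)
      rw [hcard] at this
      rw [Finset.sum_eq_sum_Ico_succ_bot (by omega), mul_add] at hlt
      linarith
    have hle : ∑ i ∈ Sᶜ, (inRate lam G S i : ℝ) *
        (limitAge lamE lam G (insert i S) - limitAge lamE lam G S) ≤ -lamE :=
      calc _ ≤ ∑ i ∈ Sᶜ, (inRate lam G S i : ℝ) * -(lamE / κ * (S.card : ℝ)⁻¹) :=
            Finset.sum_le_sum fun i hi => mul_le_mul_of_nonneg_left (hdiff i hi) (by positivity)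
        _ = -((∑ i ∈ Sᶜ, (inRate lam G S i : ℝ)) * (lamE / κ * (S.card : ℝ)⁻¹)) := by
            rw [← Finset.sum_mul]; ring
        _ ≤ -(κ * S.card * (lamE / κ * (S.card : ℝ)⁻¹)) :=
            neg_le_neg (mul_le_mul_of_nonneg_right (h S hS hbig) (by positivity))
        _ = -lamE := by field_simp
    have hpos : 0 < limitAge lamE lam G S := lt_of_le_of_lt (by positivity) hlt
    have : 0 < (S.card : ℝ) * (lam / n) * limitAge lamE lam G S := by positivity
    linarith
  -- For more than half of the vertices the source alone suffices: it reaches S at rate at least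
  -- λ/2, and the increments are nonpositive.
  · have hle : ∑ i ∈ Sᶜ, (inRate lam G S i : ℝ) *
        (limitAge lamE lam G (insert i S) - limitAge lamE lam G S) ≤ 0 :=
      Finset.sum_nonpos fun i _ => mul_nonpos_of_nonneg_of_nonpos (by positivity)
        (sub_nonpos.2 (limitAge_anti G hlamE hlam hS (Finset.subset_insert i S)))
    have hb : (n : ℝ) ≤ 2 * S.card := by exact_mod_cast (not_le.1 hbig).le
    have h2 : limitAge lamE lam G S ≤ 2 * lamE / lam := by
      rw [le_div_iff₀ hl]
      have h3 : (S.card : ℝ) * (lam / n) * limitAge lamE lam G S ≤ lamE := by linarith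
      have h4 : (lam : ℝ) / 2 ≤ S.card * (lam / n) := by
        rw [mul_div_assoc', div_le_div_iff₀ two_pos hn]
        nlinarith
      have := mul_le_mul_of_nonneg_right h4 (limitAge_nonneg (lamE := lamE) (lam := lam) G S)
      linarith
    have : 0 ≤ lamE / κ * ∑ k ∈ Finset.Ico S.card n, (k : ℝ)⁻¹ := by positivity
    linarith

/-- A lower bound for the version ages in a network where information does not spread too fast. -/
theorem le_limitAge_of_inRate_le (hlamE : 0 < lamE) (hlam : 0 < lam) {K : ℝ} (hK : 0 < K)
    (h : ∀ S : Finset (Fin n), S.Nonempty →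
      ∑ i ∈ Sᶜ, (inRate lam G S i : ℝ) ≤ lam * K * S.card) (m : ℕ) {S : Finset (Fin n)}
    (hS : S.Nonempty) (hm : S.card + m = n) :
    lamE / (lam * (K + 1)) * ∑ k ∈ Finset.Ico S.card n, (k : ℝ)⁻¹ ≤ limitAge lamE lam G S := by
  have hl : (0 : ℝ) < lam := hlam
  have hlE : (0 : ℝ) < lamE := hlamE
  have hc : (0 : ℝ) < S.card := by exact_mod_cast hS.card_pos
  have hn : (0 : ℝ) < n := by
    have := hS.card_pos
    exact_mod_cast (by omega : 0 < n)
  obtain _ | m := m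
  · have : S.card = n := by omega
    simp [this, limitAge_nonneg]
  -- Chosen so that λ_e = λKa + λa: the gossip term costs at most λKa, and the left side of the
  -- recursion is less than λa if the bound fails.
  set a : ℝ := lamE / (lam * (K + 1)) with ha
  have ha0 : 0 < a := by positivity
  have heq := limitAge_eq G hlamE hlam hS
  rw [sum_inRate_mul] at heq
  by_contra! hlt
  have hdiff : ∀ i ∈ Sᶜ, -(a * (S.card : ℝ)⁻¹) ≤
      limitAge lamE lam G (insert i S) - limitAge lamE lam G S := fun i hi => by
    have hcard := Finset.card_insert_of_notMem (Finset.mem_compl.1 hi)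
    have := le_limitAge_of_inRate_le hlamE hlam hK h m (Finset.insert_nonempty i S) (by omega)
    rw [hcard] at this
    rw [Finset.sum_eq_sum_Ico_succ_bot (by omega), mul_add] at hlt
    linarith
  have hge : -(lam * K * a) ≤ ∑ i ∈ Sᶜ, (inRate lam G S i : ℝ) *
      (limitAge lamE lam G (insert i S) - limitAge lamE lam G S) :=
    calc -(lam * K * a) = -(lam * K * S.card * (a * (S.card : ℝ)⁻¹)) := by field_simp
      _ ≤ -((∑ i ∈ Sᶜ, (inRate lam G S i : ℝ)) * (a * (S.card : ℝ)⁻¹)) :=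
          neg_le_neg (mul_le_mul_of_nonneg_right (h S hS) (by positivity))
      _ = ∑ i ∈ Sᶜ, (inRate lam G S i : ℝ) * -(a * (S.card : ℝ)⁻¹) := by
          rw [← Finset.sum_mul]; ring
      _ ≤ _ := Finset.sum_le_sum fun i hi =>
          mul_le_mul_of_nonneg_left (hdiff i hi) (by positivity)
  have hsum : ∑ k ∈ Finset.Ico S.card n, (k : ℝ)⁻¹ ≤ n * (S.card : ℝ)⁻¹ := by
    calc _ ≤ ∑ k ∈ Finset.Ico S.card n, (S.card : ℝ)⁻¹ :=
          Finset.sum_le_sum fun k hk =>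
            inv_anti₀ hc (by exact_mod_cast (Finset.mem_Ico.1 hk).1)
      _ = (n - S.card : ℕ) * (S.card : ℝ)⁻¹ := by simp
      _ ≤ _ := by gcongr; exact_mod_cast Nat.sub_le _ _
  have h1 : (S.card : ℝ) * (lam / n) * limitAge lamE lam G S < lam * a :=
    calc _ < (S.card : ℝ) * (lam / n) * (a * ∑ k ∈ Finset.Ico S.card n, (k : ℝ)⁻¹) :=
          mul_lt_mul_of_pos_left hlt (by positivity)
      _ ≤ (S.card : ℝ) * (lam / n) * (a * (n * (S.card : ℝ)⁻¹)) := by gcongr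
      _ = lam * a := by field_simp
  have h2 : (lamE : ℝ) = lam * K * a + lam * a := by rw [ha]; field_simp
  linarith

theorem averageVersionAge_le (hlamE : 0 < lamE) (hlam : 0 < lam) (hn : 0 < n) {κ : ℝ} (hκ : 0 < κ)
    (h : ∀ S : Finset (Fin n), S.Nonempty → 2 * S.card ≤ n →
      κ * S.card ≤ ∑ i ∈ Sᶜ, (inRate lam G S i : ℝ)) :
    averageVersionAge lamE lam G ≤ 2 * lamE / lam + lamE / κ * (1 + Real.log n) := by
  have hn' : (0 : ℝ) < n := by exact_mod_cast hn
  rw [averageVersionAge, div_le_iff₀ hn']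
  have hsum : ∑ k ∈ Finset.Ico 1 n, (k : ℝ)⁻¹ ≤ 1 + Real.log n := by
    refine le_trans ?_ (harmonic_le_one_add_log n)
    rw [harmonic_eq_sum_Icc]
    push_cast
    exact Finset.sum_le_sum_of_subset_of_nonneg Finset.Ico_subset_Icc_self
      fun _ _ _ => by positivity
  calc _ ≤ ∑ _j : Fin n, (2 * lamE / lam + lamE / κ * (1 + Real.log n)) := by
        refine Finset.sum_le_sum fun j _ => ?_
        rw [versionAge_eq_limitAge G hlamE]
        refine (limitAge_le_of_inRate_ge G hlamE hlam hκ h (n - 1) (Finset.singleton_nonempty j)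
          (by simp; omega)).trans ?_
        rw [Finset.card_singleton]
        gcongr
    _ = _ := by simp; ring

theorem le_averageVersionAge (hlamE : 0 < lamE) (hlam : 0 < lam) (hn : 0 < n) {K : ℝ} (hK : 0 < K)
    (h : ∀ S : Finset (Fin n), S.Nonempty →
      ∑ i ∈ Sᶜ, (inRate lam G S i : ℝ) ≤ lam * K * S.card) :
    lamE / (lam * (K + 1)) * Real.log n ≤ averageVersionAge lamE lam G := by
  have hn' : (0 : ℝ) < n := by exact_mod_cast hn
  rw [averageVersionAge, le_div_iff₀ hn']
  have hsum : Real.log n ≤ ∑ k ∈ Finset.Ico 1 n, (k : ℝ)⁻¹ := by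
    obtain ⟨m, rfl⟩ := Nat.exists_eq_succ_of_ne_zero hn.ne'
    refine (log_add_one_le_harmonic m).trans ?_
    rw [harmonic_eq_sum_Icc]
    push_cast
    exact le_of_eq rfl
  calc _ = ∑ _j : Fin n, (lamE / (lam * (K + 1)) * Real.log n) := by simp [mul_comm]
    _ ≤ _ := by
        refine Finset.sum_le_sum fun j _ => ?_
        rw [versionAge_eq_limitAge G hlamE]
        refine le_trans ?_ (le_limitAge_of_inRate_le G hlamE hlam hK h (n - 1)
          (Finset.singleton_nonempty j) (by simp; omega))
        rw [Finset.card_singleton]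
        gcongr

theorem mul_card_isolated_le_averageVersionAge (hlamE : 0 < lamE) (hlam : 0 < lam) (hn : 0 < n) :
    (lamE : ℝ) / lam * ({j | ∀ i, ¬ G.Adj j i} : Set (Fin n)).ncard ≤
      averageVersionAge lamE lam G := by
  classical
  have hn' : (0 : ℝ) < n := by exact_mod_cast hn
  have hl : (0 : ℝ) < lam := hlam
  rw [averageVersionAge, le_div_iff₀ hn']
  have hs : ({j | ∀ i, ¬ G.Adj j i} : Set (Fin n)).ncard =
      (Finset.univ.filter fun j => ∀ i, ¬ G.Adj j i).card := by
    rw [← Set.ncard_coe_finset]; simp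
  rw [hs]
  calc _ = ∑ j ∈ Finset.univ.filter (fun j => ∀ i, ¬ G.Adj j i), (lamE : ℝ) * n / lam := by
        rw [Finset.sum_const, nsmul_eq_mul]; ring
    _ = ∑ j ∈ Finset.univ.filter (fun j => ∀ i, ¬ G.Adj j i), versionAge lamE lam G j :=
        Finset.sum_congr rfl fun j hj =>
          (versionAge_of_isolated G hlamE hlam (Finset.mem_filter.1 hj).2).symm
    _ ≤ _ := Finset.sum_le_sum_of_subset_of_nonneg (Finset.filter_subset _ _)
        fun j _ _ => ENNReal.toReal_nonneg

/-! ### Edge counts in binomial random graphs -/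

section RandomGraph

open scoped Classical unitInterval

open SimpleGraph (binomialRandom)

instance instMeasurableSingletonClassSimpleGraph (V : Type*) [Finite V] :
    MeasurableSingletonClass (SimpleGraph V) where
  measurableSet_singleton G := by
    have h : ({G} : Set (SimpleGraph V)) = SimpleGraph.edgeSet ⁻¹' {G.edgeSet} := by
      ext H; simp
    rw [h]
    exact SimpleGraph.measurableEmbedding_edgeSet.measurable (measurableSet_singleton _)

variable {V : Type*} [Fintype V] [DecidableEq V] (p : I)

theorem binomialRandom_real_singleton (G : SimpleGraph V) :
    (binomialRandom V p).real {G} = (∏ _e ∈ G.edgeFinset, (p : ℝ)) *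
      ∏ _e ∈ (⊤ : SimpleGraph V).edgeFinset \ G.edgeFinset, (1 - p : ℝ) := by
  have hc : ((⊤ : SimpleGraph V).edgeFinset \ G.edgeFinset).card =
      (Nat.card V).choose 2 - G.edgeSet.ncard := by
    rw [Finset.card_sdiff_of_subset (SimpleGraph.edgeFinset_mono le_top),
      SimpleGraph.card_edgeFinset_top_eq_card_choose_two, Nat.card_eq_fintype_card,
      ← SimpleGraph.coe_edgeFinset, Set.ncard_coe_finset]
  have hc' : G.edgeFinset.card = G.edgeSet.ncard := by
    rw [← SimpleGraph.coe_edgeFinset, Set.ncard_coe_finset]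
  rw [measureReal_def, SimpleGraph.binomialRandom_singleton, Finset.prod_const, Finset.prod_const,
    hc, hc']
  simp

/-- The generating function of the edges of a binomial random graph. -/
theorem integral_prod_edgeFinset (w : Sym2 V → ℝ) :
    ∫ G, ∏ e ∈ G.edgeFinset, w e ∂binomialRandom V p =
      ∏ e ∈ (⊤ : SimpleGraph V).edgeFinset, (p * w e + (1 - p)) := by
  -- The expanded product is a sum over sets of pairs, and these correspond to graphs through their
  -- edge sets.
  rw [integral_fintype .of_finite, Finset.prod_add]
  refine Finset.sum_bij' (fun G _ => G.edgeFinset)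
    (fun s _ => SimpleGraph.fromEdgeSet (s : Set (Sym2 V))) ?_ ?_ ?_ ?_ ?_
  · intro G _
    exact Finset.mem_powerset.2 (SimpleGraph.edgeFinset_mono le_top)
  · intro s _
    exact Finset.mem_univ _
  · intro G _
    simp
  · intro s hs
    ext e
    have := @Finset.mem_powerset.1 hs e
    simp only [SimpleGraph.mem_edgeFinset, SimpleGraph.edgeSet_fromEdgeSet, Set.mem_sdiff,
      Finset.mem_coe, SimpleGraph.edgeSet_top] at this ⊢
    exact ⟨fun h => h.1, fun h => ⟨h, this h⟩⟩
  · intro G _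
    rw [binomialRandom_real_singleton, smul_eq_mul, Finset.prod_mul_distrib]
    ring

/-- The number of edges of `G` among the pairs in `A`. -/
def edgeCount (A : Finset (Sym2 V)) (G : SimpleGraph V) : ℕ := (A.filter (· ∈ G.edgeSet)).card

theorem integral_pow_edgeCount {A : Finset (Sym2 V)} (hA : A ⊆ (⊤ : SimpleGraph V).edgeFinset)
    (x : ℝ) : ∫ G, x ^ edgeCount A G ∂binomialRandom V p = (p * x + (1 - p)) ^ A.card := by
  have h := integral_prod_edgeFinset p (fun e => if e ∈ A then x else 1)
  have h1 : ∀ G : SimpleGraph V, ∏ e ∈ G.edgeFinset, (if e ∈ A then x else 1) =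
      x ^ edgeCount A G := fun G => by
    rw [Finset.prod_ite, Finset.prod_const_one, mul_one, Finset.prod_const, edgeCount]
    congr 2
    ext e; simp [and_comm]
  have h2 : ∏ e ∈ (⊤ : SimpleGraph V).edgeFinset, (p * (if e ∈ A then x else 1) + (1 - p)) =
      (p * x + (1 - p)) ^ A.card := by
    rw [← Finset.prod_const, ← Finset.prod_subset hA]
    · exact Finset.prod_congr rfl fun e he => by rw [if_pos he]
    · intro e _ he
      rw [if_neg he]; ring
  simpa only [h1, h2] using h

/-- Chernoff's bound for the upper tail of the number of edges in `A`. -/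
theorem measureReal_le_edgeCount {A : Finset (Sym2 V)}
    (hA : A ⊆ (⊤ : SimpleGraph V).edgeFinset) (a : ℝ) :
    (binomialRandom V p).real {G | a ≤ edgeCount A G} ≤ Real.exp (2 * p * A.card - a) := by
  have h := mul_meas_ge_le_integral_of_nonneg (μ := binomialRandom V p)
    (f := fun G => Real.exp 1 ^ edgeCount A G) (ae_of_all _ fun G => by positivity) .of_finite
    (Real.exp a)
  have h1 : {G : SimpleGraph V | Real.exp a ≤ Real.exp 1 ^ edgeCount A G} =
      {G | a ≤ edgeCount A G} := by
    ext G; simp [← Real.exp_nat_mul]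
  rw [integral_pow_edgeCount p hA, h1] at h
  have hp := p.2.1
  -- The factor 2 comes from e < 3: pe + 1 - p ≤ 1 + 2p.
  have h2 : (p * Real.exp 1 + (1 - p) : ℝ) ≤ Real.exp (2 * p) := by
    have := Real.exp_one_lt_three
    have := Real.add_one_le_exp (2 * p : ℝ)
    nlinarith
  rw [Real.exp_sub, le_div_iff₀ (Real.exp_pos a), mul_comm]
  refine h.trans ?_
  rw [mul_comm (2 * p : ℝ), Real.exp_nat_mul]
  have := p.2.2
  exact pow_le_pow_left₀ (by have := Real.exp_pos 1; nlinarith) h2 _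

/-- Chernoff's bound for the lower tail of the number of edges in `A`. -/
theorem measureReal_edgeCount_le {A : Finset (Sym2 V)}
    (hA : A ⊆ (⊤ : SimpleGraph V).edgeFinset) (a : ℝ) :
    (binomialRandom V p).real {G | edgeCount A G ≤ a} ≤ Real.exp (a - p * A.card / 2) := by
  have h := mul_meas_ge_le_integral_of_nonneg (μ := binomialRandom V p)
    (f := fun G => Real.exp (-1) ^ edgeCount A G) (ae_of_all _ fun G => by positivity) .of_finite
    (Real.exp (-a))
  have h1 : {G : SimpleGraph V | Real.exp (-a) ≤ Real.exp (-1) ^ edgeCount A G} =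
      {G | (edgeCount A G : ℝ) ≤ a} := by
    ext G; simp [← Real.exp_nat_mul]
  rw [integral_pow_edgeCount p hA, h1] at h
  have hp := p.2.1
  have h2 : (p * Real.exp (-1) + (1 - p) : ℝ) ≤ Real.exp (-(p / 2)) := by
    have he : Real.exp (-1) ≤ 1 / 2 := by
      rw [Real.exp_neg, ← one_div]
      have := Real.add_one_le_exp (1 : ℝ)
      exact one_div_le_one_div_of_le two_pos (by linarith)
    have := Real.add_one_le_exp (-(p / 2) : ℝ)
    nlinarith
  rw [show a - p * A.card / 2 = -(p * A.card / 2) - -a by ring, Real.exp_sub,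
    le_div_iff₀ (Real.exp_pos _), mul_comm]
  refine h.trans ?_
  rw [show -(p * A.card / 2 : ℝ) = A.card * -(p / 2) by ring, Real.exp_nat_mul]
  have := p.2.2
  exact pow_le_pow_left₀ (by have := Real.exp_pos (-1); nlinarith) h2 _

/-! ### Degrees and cuts -/

/-- The pairs with exactly one end in `S`. -/
def cutPairs (S : Finset V) : Finset (Sym2 V) := (S ×ˢ Sᶜ).image fun x => s(x.1, x.2)

theorem injOn_cutPairs (S : Finset V) :
    Set.InjOn (fun x : V × V => s(x.1, x.2)) ↑(S ×ˢ Sᶜ) := by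
  rintro ⟨a, b⟩ hab ⟨c, d⟩ hcd h
  simp only [Finset.coe_product, Finset.coe_compl, Set.mem_prod, Finset.mem_coe,
    Set.mem_compl_iff] at hab hcd
  rcases Sym2.eq_iff.1 h with ⟨rfl, rfl⟩ | ⟨rfl, rfl⟩
  · rfl
  · exact absurd hcd.1 hab.2

theorem cutPairs_subset (S : Finset V) : cutPairs S ⊆ (⊤ : SimpleGraph V).edgeFinset := by
  intro e he
  obtain ⟨⟨a, b⟩, hab, rfl⟩ := Finset.mem_image.1 he
  simp only [Finset.mem_product, Finset.mem_compl] at hab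
  simp only [SimpleGraph.mem_edgeFinset, SimpleGraph.mem_edgeSet, SimpleGraph.top_adj]
  rintro rfl
  exact hab.2 hab.1

theorem card_cutPairs (S : Finset V) : (cutPairs S).card = S.card * Sᶜ.card := by
  rw [cutPairs, Finset.card_image_of_injOn (injOn_cutPairs S), Finset.card_product]

theorem edgeCount_cutPairs (S : Finset V) (G : SimpleGraph V) :
    edgeCount (cutPairs S) G = ∑ i ∈ Sᶜ, ∑ j ∈ S, if G.Adj i j then 1 else 0 := by
  rw [edgeCount, cutPairs, Finset.filter_image, Finset.card_image_of_injOn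
    ((injOn_cutPairs S).mono (by exact_mod_cast Finset.filter_subset _ _)), Finset.card_filter,
    Finset.sum_product_right]
  simp [G.adj_comm]

/-- Degrees become edge counts of stars, so the same Chernoff bounds serve degrees and cuts. -/
theorem edgeCount_cutPairs_singleton (G : SimpleGraph V) (v : V) [Fintype (G.neighborSet v)] :
    edgeCount (cutPairs {v}) G = G.degree v := by
  rw [edgeCount_cutPairs]
  simp only [Finset.sum_singleton]
  rw [← Finset.card_filter, ← SimpleGraph.card_neighborFinset_eq_degree]
  congr 1
  ext i
  simp only [Finset.mem_filter, Finset.mem_compl, Finset.mem_singleton,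
    SimpleGraph.mem_neighborFinset, G.adj_comm v i, and_iff_right_iff_imp]
  rintro h rfl
  exact G.irrefl h

theorem edgeCount_cutPairs_le (S : Finset V) (G : SimpleGraph V) :
    edgeCount (cutPairs S) G ≤ ∑ j ∈ S, edgeCount (cutPairs {j}) G := by
  rw [edgeCount_cutPairs, Finset.sum_comm]
  refine Finset.sum_le_sum fun j hj => ?_
  rw [edgeCount_cutPairs]
  simp only [Finset.sum_singleton]
  exact Finset.sum_le_sum_of_subset (Finset.compl_subset_compl.2 (by simpa using hj))

/-- A binomial random graph has almost regular degrees and a large expansion, if it is not too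
sparse. -/
theorem measureReal_degree_expansion (N : ℕ) (hN : Fintype.card V = N) :
    (binomialRandom V p).real {G | (∀ v : V, (edgeCount (cutPairs {v}) G : ℝ) ≤ 4 * (N * (p : ℝ))) ∧
      ∀ S : Finset V, S.Nonempty → 2 * S.card ≤ N →
        (p : ℝ) * (S.card * Sᶜ.card) / 8 ≤ edgeCount (cutPairs S) G}ᶜ ≤
      N * Real.exp (-2 * (N * (p : ℝ))) +
        (Real.exp (N * Real.exp (-(3 / 16) * (N * (p : ℝ)))) - 1) := by
  set x := Real.exp (-(3 / 16) * (N * (p : ℝ))) with hx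
  have hp := p.2.1
  have hsub : {G : SimpleGraph V | (∀ v : V, (edgeCount (cutPairs {v}) G : ℝ) ≤ 4 * (N * (p : ℝ))) ∧
      ∀ S : Finset V, S.Nonempty → 2 * S.card ≤ N →
        (p : ℝ) * (S.card * Sᶜ.card) / 8 ≤ edgeCount (cutPairs S) G}ᶜ ⊆
      (⋃ v : V, {G | 4 * (N * (p : ℝ)) ≤ (edgeCount (cutPairs {v}) G : ℝ)}) ∪
      ⋃ S ∈ Finset.univ.filter (fun S : Finset V => S.Nonempty ∧ 2 * S.card ≤ N),
        {G | (edgeCount (cutPairs S) G : ℝ) ≤ (p : ℝ) * (S.card * Sᶜ.card) / 8} := by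
    intro G hG
    simp only [Set.mem_compl_iff, Set.mem_ofPred_eq, not_and_or, not_forall, not_le] at hG
    rcases hG with ⟨v, hv⟩ | ⟨S, h1, h2, h3⟩
    · exact Or.inl (Set.mem_iUnion.2 ⟨v, hv.le⟩)
    · exact Or.inr (Set.mem_iUnion₂.2 ⟨S, by simp [h1, h2], h3.le⟩)
  refine (measureReal_mono hsub).trans ((measureReal_union_le _ _).trans (add_le_add ?_ ?_))
  · refine (measureReal_iUnion_fintype_le _).trans ?_
    have hle : ∀ v : V, (binomialRandom V p).real
        {G | 4 * (N * (p : ℝ)) ≤ (edgeCount (cutPairs {v}) G : ℝ)} ≤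
        Real.exp (-2 * (N * (p : ℝ))) := fun v => by
      refine (measureReal_le_edgeCount p (cutPairs_subset _) _).trans ?_
      rw [Real.exp_le_exp, card_cutPairs]
      have : (({v} : Finset V).card * ({v} : Finset V)ᶜ.card : ℕ) ≤ N := by
        simp [Finset.card_compl, hN]
      have : ((({v} : Finset V).card * ({v} : Finset V)ᶜ.card : ℕ) : ℝ) ≤ N := by
        exact_mod_cast this
      nlinarith
    refine (Finset.sum_le_sum fun v _ => hle v).trans (le_of_eq ?_)
    rw [Finset.sum_const, Finset.card_univ, hN, nsmul_eq_mul]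
  · refine (measureReal_biUnion_finset_le _ _).trans ?_
    have hle : ∀ S ∈ Finset.univ.filter (fun S : Finset V => S.Nonempty ∧ 2 * S.card ≤ N),
        (binomialRandom V p).real
          {G | (edgeCount (cutPairs S) G : ℝ) ≤ (p : ℝ) * (S.card * Sᶜ.card) / 8} ≤ x ^ S.card := by
      intro S hS
      obtain ⟨-, -, hS⟩ := Finset.mem_filter.1 hS
      refine (measureReal_edgeCount_le p (cutPairs_subset _) _).trans ?_
      -- The Chernoff exponent is (1/8 - 1/2) p|S||Sᶜ|; with |Sᶜ| ≥ N/2 this is at most -(3/16)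
      -- Np|S|.
      rw [hx, ← Real.exp_nat_mul, Real.exp_le_exp, card_cutPairs, Nat.cast_mul]
      have hc : (N : ℝ) ≤ 2 * (Sᶜ.card : ℝ) := by
        have := Finset.card_compl_add_card S
        exact_mod_cast (by omega : N ≤ 2 * Sᶜ.card)
      have := mul_le_mul_of_nonneg_left hc (by positivity : (0 : ℝ) ≤ p * S.card)
      nlinarith
    refine (Finset.sum_le_sum hle).trans ?_
    have hsub2 : Finset.univ.filter (fun S : Finset V => S.Nonempty ∧ 2 * S.card ≤ N) ⊆
        (Finset.univ : Finset (Finset V)).erase ∅ := fun S hS => by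
      simpa using (Finset.mem_filter.1 hS).2.1.ne_empty
    refine (Finset.sum_le_sum_of_subset_of_nonneg hsub2 fun _ _ _ => by positivity).trans ?_
    -- The union bound over all sets is a binomial sum; removing the empty set subtracts 1.
    have htot : ∑ S : Finset V, x ^ S.card = (x + 1) ^ N := by
      have := Finset.sum_pow_mul_eq_add_pow x 1 (Finset.univ : Finset V)
      simpa [hN] using this
    have := Finset.sum_erase_add (f := fun S : Finset V => x ^ S.card) Finset.univ
      (Finset.mem_univ ∅)
    simp only [Finset.card_empty, pow_zero] at this
    have h4 : (x + 1) ^ N ≤ Real.exp (N * x) := by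
      rw [Real.exp_nat_mul]
      exact pow_le_pow_left₀ (by positivity) (Real.add_one_le_exp x) N
    linarith

/-! ### Isolated vertices by the second moment method -/

/-- The number of isolated vertices of `G`. -/
def isolatedCount (G : SimpleGraph V) : ℕ := ({v | ∀ i, ¬ G.Adj v i} : Set V).ncard

/-- Since 0^k is the indicator of k = 0, the moments of the count are generating functions of edge
counts at 0. -/
theorem isolatedCount_eq (G : SimpleGraph V) :
    (isolatedCount G : ℝ) = ∑ v, (0 : ℝ) ^ edgeCount (cutPairs {v}) G := by
  have h : ∀ v, (edgeCount (cutPairs {v}) G = 0 ↔ ∀ i, ¬ G.Adj v i) := fun v => by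
    rw [edgeCount_cutPairs_singleton, SimpleGraph.degree_eq_zero]
    simp [SimpleGraph.IsIsolated]
  simp only [zero_pow_eq, h]
  rw [← Finset.sum_filter, Finset.sum_const, nsmul_eq_mul, mul_one, isolatedCount,
    ← Set.ncard_coe_finset]
  simp

/-- The stars at u and v share at most the pair uv. -/
theorem card_cutPairs_union {u v : V} (h : u ≠ v) :
    2 * (Fintype.card V - 1) - 1 ≤ (cutPairs {u} ∪ cutPairs {v}).card := by
  have h1 := Finset.card_union_add_card_inter (cutPairs {u}) (cutPairs {v})
  have h2 : cutPairs {u} ∩ cutPairs {v} ⊆ {s(u, v)} := by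
    intro e he
    obtain ⟨h1, h2⟩ := Finset.mem_inter.1 he
    obtain ⟨⟨a, b⟩, hab, rfl⟩ := Finset.mem_image.1 h1
    obtain ⟨⟨c, d⟩, hcd, h3⟩ := Finset.mem_image.1 h2
    simp only [Finset.mem_product, Finset.mem_compl, Finset.mem_singleton] at hab hcd
    obtain ⟨rfl, -⟩ := hab
    obtain ⟨rfl, -⟩ := hcd
    rcases Sym2.eq_iff.1 h3 with ⟨h4, -⟩ | ⟨h4, -⟩
    · exact absurd h4.symm h
    · have h4 : c = b := h4
      simp [h4]
  have h3 := Finset.card_le_card h2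
  simp only [card_cutPairs, Finset.card_singleton, Finset.card_compl, one_mul] at h1 h3
  omega

theorem integral_isolatedCount : ∫ G, (isolatedCount G : ℝ) ∂binomialRandom V p =
    Fintype.card V * (1 - p : ℝ) ^ (Fintype.card V - 1) := by
  simp only [isolatedCount_eq]
  rw [integral_finsetSum _ fun _ _ => .of_finite]
  simp [integral_pow_edgeCount p (cutPairs_subset _), card_cutPairs, Finset.card_compl]

theorem integral_isolatedCount_sq_le (hp : (p : ℝ) < 1) :
    ∫ G, (isolatedCount G : ℝ) ^ 2 ∂binomialRandom V p ≤
      Fintype.card V * (1 - p : ℝ) ^ (Fintype.card V - 1) +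
      (Fintype.card V * (1 - p : ℝ) ^ (Fintype.card V - 1)) ^ 2 / (1 - p) := by
  have hq : (0 : ℝ) < 1 - p := by linarith
  have hq1 : (1 - p : ℝ) ≤ 1 := by linarith [p.2.1]
  simp only [isolatedCount_eq, sq, Finset.sum_mul_sum]
  rw [integral_finsetSum _ fun _ _ => .of_finite]
  have hu : ∀ u v : V, ∀ G : SimpleGraph V,
      (0 : ℝ) ^ edgeCount (cutPairs {u}) G * 0 ^ edgeCount (cutPairs {v}) G =
        0 ^ edgeCount (cutPairs {u} ∪ cutPairs {v}) G := fun u v G => by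
    rw [← pow_add, zero_pow_eq, zero_pow_eq]
    congr 1
    simp only [edgeCount, Finset.filter_union, Nat.add_eq_zero_iff, Finset.card_eq_zero,
      Finset.union_eq_empty]
  -- For u ≠ v the overlap of the stars costs one factor 1 - p, whence the division. The second
  -- summand is also kept on the diagonal, where it is merely nonnegative.
  have hterm : ∀ u v : V, ∫ G, (0 : ℝ) ^ edgeCount (cutPairs {u}) G *
      0 ^ edgeCount (cutPairs {v}) G ∂binomialRandom V p ≤
      (if u = v then (1 - p : ℝ) ^ (Fintype.card V - 1) else 0) +
        (1 - p : ℝ) ^ (2 * (Fintype.card V - 1)) / (1 - p) := fun u v => by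
    simp only [hu]
    rw [integral_pow_edgeCount p (Finset.union_subset (cutPairs_subset _) (cutPairs_subset _)),
      mul_zero, zero_add]
    split_ifs with h
    · subst h
      rw [Finset.union_self, card_cutPairs]
      simp only [Finset.card_singleton, Finset.card_compl, one_mul]
      have : 0 ≤ (1 - p : ℝ) ^ (2 * (Fintype.card V - 1)) / (1 - p) := by positivity
      linarith
    · rw [zero_add, le_div_iff₀ hq, ← pow_succ]
      refine pow_le_pow_of_le_one hq.le hq1 ?_
      have := card_cutPairs_union h
      omega
  calc _ ≤ ∑ u : V, ∑ v : V, ((if u = v then (1 - p : ℝ) ^ (Fintype.card V - 1) else 0) +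
        (1 - p : ℝ) ^ (2 * (Fintype.card V - 1)) / (1 - p)) := by
        refine Finset.sum_le_sum fun u _ => ?_
        rw [integral_finsetSum _ fun _ _ => .of_finite]
        exact Finset.sum_le_sum fun v _ => hterm u v
    _ = _ := by
        simp only [Finset.sum_add_distrib, Finset.sum_ite_eq, Finset.mem_univ, if_true,
          Finset.sum_const, Finset.card_univ, nsmul_eq_mul]
        ring

/-- Chebyshev's inequality for the number of isolated vertices. -/
theorem measureReal_isolatedCount_le [Nonempty V] (hp : (p : ℝ) < 1) {m : ℝ}
    (hm : m = Fintype.card V * (1 - p : ℝ) ^ (Fintype.card V - 1)) :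
    (binomialRandom V p).real {G | (isolatedCount G : ℝ) < m / 2} ≤
      4 / m + 4 * (p / (1 - p)) := by
  have hq : (0 : ℝ) < 1 - p := by linarith
  have hm0 : 0 < m := by rw [hm]; positivity
  have h := mul_meas_ge_le_integral_of_nonneg (μ := binomialRandom V p)
    (f := fun G => ((isolatedCount G : ℝ) - m) ^ 2) (ae_of_all _ fun G => by positivity) .of_finite
    (m ^ 2 / 4)
  have h1 : ∫ G, ((isolatedCount G : ℝ) - m) ^ 2 ∂binomialRandom V p ≤ m + m ^ 2 * (p / (1 - p)) := by
    have heq : ∀ G : SimpleGraph V, ((isolatedCount G : ℝ) - m) ^ 2 =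
        (isolatedCount G : ℝ) ^ 2 - 2 * m * isolatedCount G + m ^ 2 := fun G => by ring
    simp only [heq]
    rw [integral_add .of_finite .of_finite, integral_sub .of_finite .of_finite,
      integral_const_mul, integral_isolatedCount, ← hm]
    have h2 := integral_isolatedCount_sq_le (V := V) p hp
    rw [← hm] at h2
    simp only [integral_const, probReal_univ, one_smul]
    have h3 : m ^ 2 / (1 - p) = m ^ 2 + m ^ 2 * (p / (1 - p)) := by field_simp; ring
    linarith
  have hsub : {G : SimpleGraph V | (isolatedCount G : ℝ) < m / 2} ⊆
      {G | m ^ 2 / 4 ≤ ((isolatedCount G : ℝ) - m) ^ 2} := fun G hG => by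
    simp only [Set.mem_ofPred_eq] at hG ⊢
    nlinarith
  refine (measureReal_mono hsub).trans ?_
  have h4 := h.trans h1
  rw [← mul_le_mul_iff_right₀ (by positivity : 0 < m ^ 2 / 4)]
  refine h4.trans (le_of_eq ?_)
  field_simp

end RandomGraph

/-! ### Asymptotics in the two regimes -/

section Asymptotics

open scoped Classical

open SimpleGraph (binomialRandom)

theorem sum_inRate_eq (lam : ℝ≥0) (S : Finset (Fin n)) :
    ∑ i ∈ Sᶜ, (inRate lam G S i : ℝ) =
      ∑ i ∈ Sᶜ, ∑ j ∈ S, if G.Adj i j then (lam : ℝ) / edgeCount (cutPairs {i}) G else 0 := by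
  refine Finset.sum_congr rfl fun i _ => ?_
  rw [inRate, NNReal.coe_sum]
  refine Finset.sum_congr rfl fun j _ => ?_
  rw [edgeCount_cutPairs_singleton G i]
  simp only [rate]
  split_ifs
  · push_cast; rfl
  · rfl

theorem edgeCount_cutPairs_singleton_pos {i j : Fin n} (h : G.Adj i j) :
    (0 : ℝ) < edgeCount (cutPairs {i}) G := by
  rw [edgeCount_cutPairs_singleton]
  exact_mod_cast (SimpleGraph.degree_pos_iff_exists_adj (G := G) (v := i)).2 ⟨j, h⟩

/-- Every edge into S carries rate λ divided by the degree of its sender, hence at least λ/D. -/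
theorem le_sum_inRate {D κ : ℝ} (hD : 0 < D)
    (hdeg : ∀ v : Fin n, (edgeCount (cutPairs {v}) G : ℝ) ≤ D) {S : Finset (Fin n)}
    (hS : κ * D * S.card ≤ edgeCount (cutPairs S) G) :
    lam * κ * S.card ≤ ∑ i ∈ Sᶜ, (inRate lam G S i : ℝ) := by
  calc lam * κ * S.card = lam / D * (κ * D * S.card) := by field_simp
    _ ≤ lam / D * edgeCount (cutPairs S) G := by gcongr
    _ = ∑ i ∈ Sᶜ, ∑ j ∈ S, if G.Adj i j then (lam : ℝ) / D else 0 := by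
        rw [edgeCount_cutPairs]
        push_cast
        simp only [Finset.mul_sum, mul_ite, mul_one, mul_zero]
    _ ≤ _ := by
        rw [sum_inRate_eq]
        refine Finset.sum_le_sum fun i _ => Finset.sum_le_sum fun j _ => ?_
        split_ifs with h
        · have := edgeCount_cutPairs_singleton_pos G h
          gcongr
          exact hdeg i
        · exact le_rfl

/-- Every edge into S carries rate at most λ/d, and each vertex of S has at most Kd edges. -/
theorem sum_inRate_le {d K : ℝ} (hd : 0 < d)
    (hdeg : ∀ v : Fin n, (edgeCount (cutPairs {v}) G : ℝ) ≤ K * d)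
    (hdeg' : ∀ v : Fin n, d ≤ edgeCount (cutPairs {v}) G) (S : Finset (Fin n)) :
    ∑ i ∈ Sᶜ, (inRate lam G S i : ℝ) ≤ lam * K * S.card := by
  calc _ ≤ ∑ i ∈ Sᶜ, ∑ j ∈ S, (if G.Adj i j then (lam : ℝ) / d else 0) := by
        rw [sum_inRate_eq]
        refine Finset.sum_le_sum fun i _ => Finset.sum_le_sum fun j _ => ?_
        split_ifs with h
        · gcongr
          exact hdeg' i
        · exact le_rfl
    _ = lam / d * edgeCount (cutPairs S) G := by
        rw [edgeCount_cutPairs]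
        push_cast
        simp only [Finset.mul_sum, mul_ite, mul_one, mul_zero]
    _ ≤ lam / d * (S.card * (K * d)) := by
        gcongr
        have h := edgeCount_cutPairs_le S G
        calc (edgeCount (cutPairs S) G : ℝ) ≤ ∑ j ∈ S, (edgeCount (cutPairs {j}) G : ℝ) := by
              exact_mod_cast h
          _ ≤ ∑ j ∈ S, K * d := Finset.sum_le_sum fun j _ => hdeg j
          _ = _ := by simp
    _ = _ := by field_simp

/-- Nearly regular graphs with a large expansion have logarithmic average version age. -/
theorem averageVersionAge_of_expansion (hlamE : 0 < lamE) (hlam : 0 < lam) (hn : 2 ≤ n) {p : ℝ}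
    (hp : 0 < p) (hdeg : ∀ v : Fin n, (edgeCount (cutPairs {v}) G : ℝ) ≤ 4 * (n * p))
    (hexp : ∀ S : Finset (Fin n), S.Nonempty → 2 * S.card ≤ n →
      p * (S.card * Sᶜ.card) / 8 ≤ edgeCount (cutPairs S) G) :
    lamE / (lam * (64 + 1)) * Real.log n ≤ averageVersionAge lamE lam G ∧
      averageVersionAge lamE lam G ≤ 2 * lamE / lam + lamE / (lam * (1 / 64)) * (1 + Real.log n) := by
  have hn0 : (0 : ℝ) < n := by exact_mod_cast (by omega : 0 < n)
  have hl : (0 : ℝ) < lam := hlam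
  have hexp' : ∀ S : Finset (Fin n), S.Nonempty → 2 * S.card ≤ n →
      1 / 64 * (4 * (n * p)) * S.card ≤ edgeCount (cutPairs S) G := fun S hS h2 => by
    refine le_trans ?_ (hexp S hS h2)
    have hc : (n : ℝ) ≤ 2 * (Sᶜ.card : ℝ) := by
      have := Finset.card_compl_add_card S
      rw [Fintype.card_fin] at this
      exact_mod_cast (by omega : n ≤ 2 * Sᶜ.card)
    have := mul_le_mul_of_nonneg_left hc (by positivity : (0 : ℝ) ≤ p * S.card)
    nlinarith
  constructor
  · refine le_averageVersionAge G hlamE hlam (by omega) (by norm_num) fun S _ => ?_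
    -- Expansion of singletons is a lower bound np/16 for the degrees; against the upper bound 4np
    -- this gives the ratio 64.
    refine sum_inRate_le G (d := n * p / 16) (by positivity) (fun v => ?_) (fun v => ?_) S
    · refine (hdeg v).trans (le_of_eq (by ring))
    · refine le_trans (le_of_eq ?_) (hexp' {v} (Finset.singleton_nonempty v) (by simpa using hn))
      rw [Finset.card_singleton, Nat.cast_one]; ring
  · refine averageVersionAge_le G hlamE hlam (by omega) (by positivity) fun S hS h2 => ?_
    exact le_sum_inRate G (by positivity) hdeg (hexp' S hS h2)

theorem gnpProb_eq (n : ℕ) (p : unitInterval) (Q : SimpleGraph (Fin n) → Prop) :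
    gnpProb n p Q = ENNReal.ofReal ((binomialRandom (Fin n) p).real {G | Q G}) := by
  rw [gnpProb, ofReal_measureReal]

theorem aas_of_tendsto {p : ℕ → unitInterval} {Q : (n : ℕ) → SimpleGraph (Fin n) → Prop} {b : ℕ → ℝ}
    (hb : Tendsto b atTop (𝓝 0))
    (h : ∀ᶠ n in atTop, (binomialRandom (Fin n) (p n)).real {G | Q n G}ᶜ ≤ b n) : AAS p Q := by
  have hlim : Tendsto (fun n => (binomialRandom (Fin n) (p n)).real {G | Q n G}) atTop (𝓝 1) := by
    have h1 : Tendsto (fun n => 1 - b n) atTop (𝓝 1) := by simpa using hb.const_sub 1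
    refine tendsto_of_tendsto_of_tendsto_of_le_of_le' h1 tendsto_const_nhds ?_
      (Eventually.of_forall fun n => measureReal_le_one)
    filter_upwards [h] with n hn
    rw [probReal_compl_eq_one_sub (Set.toFinite _).measurableSet] at hn
    linarith
  have := ENNReal.tendsto_ofReal hlim
  simpa only [AAS, gnpProb_eq, ENNReal.ofReal_one] using this

theorem AAS.mono {p : ℕ → unitInterval} {Q R : (n : ℕ) → SimpleGraph (Fin n) → Prop}
    (hQ : AAS p Q) (h : ∀ᶠ n in atTop, ∀ G, Q n G → R n G) : AAS p R := by
  refine tendsto_of_tendsto_of_tendsto_of_le_of_le' hQ tendsto_const_nhds ?_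
    (Eventually.of_forall fun n => prob_le_one)
  filter_upwards [h] with n hn
  exact measure_mono fun G hG => hn G hG

theorem AAS.tendsto_zero {p : ℕ → unitInterval} {Q R : (n : ℕ) → SimpleGraph (Fin n) → Prop}
    (hQ : AAS p Q) (h : ∀ᶠ n in atTop, ∀ G, Q n G → ¬ R n G) :
    Tendsto (fun n => gnpProb n (p n) (R n)) atTop (𝓝 0) := by
  have h1 : Tendsto (fun n => 1 - gnpProb n (p n) (Q n)) atTop (𝓝 (1 - 1)) :=
    ENNReal.Tendsto.sub tendsto_const_nhds hQ (by simp)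
  rw [tsub_self] at h1
  refine tendsto_of_tendsto_of_tendsto_of_le_of_le' tendsto_const_nhds h1
    (Eventually.of_forall fun n => zero_le) ?_
  filter_upwards [h] with n hn
  simp only [gnpProb]
  rw [← prob_compl_eq_one_sub (Set.toFinite _).measurableSet]
  exact measure_mono fun G hR hQ => hn G hQ hR

theorem tendsto_natCast_log : Tendsto (fun n : ℕ => Real.log n) atTop atTop :=
  Real.tendsto_log_atTop.comp tendsto_natCast_atTop_atTop

/-- Above the connectivity threshold the average version age is logarithmic. -/
theorem aas_averageVersionAge_log (hlamE : 0 < lamE) (hlam : 0 < lam) {p : ℕ → unitInterval}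
    (hp : ∀ᶠ n : ℕ in atTop, 100 * Real.log n ≤ n * (p n : ℝ)) :
    AAS p (fun n G => lamE / (lam * (64 + 1)) * Real.log n ≤ averageVersionAge lamE lam G ∧
      averageVersionAge lamE lam G ≤ 130 * lamE / lam * Real.log n) := by
  have hb : Tendsto (fun n : ℕ => (n : ℝ)⁻¹ + (Real.exp (n : ℝ)⁻¹ - 1)) atTop (𝓝 0) := by
    have h := tendsto_inv_atTop_nhds_zero_nat (𝕜 := ℝ)
    have h2 := (Real.continuous_exp.tendsto 0).comp h
    rw [Real.exp_zero] at h2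
    simpa [Function.comp_def] using h.add (h2.sub_const 1)
  refine aas_of_tendsto hb ?_
  filter_upwards [hp, tendsto_natCast_log.eventually_ge_atTop 1, eventually_ge_atTop 2]
    with n hnp hlog hn
  have hn0 : (0 : ℝ) < n := by exact_mod_cast (by omega : 0 < n)
  have hl : (0 : ℝ) < lam := hlam
  have hlE : (0 : ℝ) < lamE := hlamE
  have hp0 : (0 : ℝ) < p n := by
    by_contra! h
    have := mul_nonpos_of_nonneg_of_nonpos hn0.le h
    linarith
  have hbound := measureReal_degree_expansion (V := Fin n) (p n) n (Fintype.card_fin n)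
  have hexp : Real.exp (-2 * Real.log n) = ((n : ℝ) * n)⁻¹ := by
    rw [show -2 * Real.log n = -(Real.log n + Real.log n) by ring, Real.exp_neg, Real.exp_add,
      Real.exp_log hn0]
  have h1 : (n : ℝ) * Real.exp (-2 * (n * (p n : ℝ))) ≤ (n : ℝ)⁻¹ := by
    calc _ ≤ (n : ℝ) * Real.exp (-2 * Real.log n) := by gcongr _ * Real.exp ?_; linarith
      _ = _ := by rw [hexp]; field_simp
  -- The constant 100 is ample: all that is used is (3/16) · 100 ≥ 2.
  have h2 : (n : ℝ) * Real.exp (-(3 / 16) * (n * (p n : ℝ))) ≤ (n : ℝ)⁻¹ := by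
    calc _ ≤ (n : ℝ) * Real.exp (-2 * Real.log n) := by gcongr _ * Real.exp ?_; linarith
      _ = _ := by rw [hexp]; field_simp
  refine (measureReal_mono (Set.compl_subset_compl.2 ?_)).trans (hbound.trans
    (add_le_add h1 (sub_le_sub_right (Real.exp_le_exp.2 h2) 1)))
  rintro G ⟨hdeg, hcut⟩
  obtain ⟨hlow, hup⟩ := averageVersionAge_of_expansion (lamE := lamE) (lam := lam) G hlamE hlam hn
    hp0 hdeg hcut
  refine ⟨hlow, hup.trans ?_⟩
  have h3 : 2 * (lamE : ℝ) / lam + lamE / (lam * (1 / 64)) * (1 + Real.log n) =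
      lamE / lam * (66 + 64 * Real.log n) := by field_simp; ring
  have h4 : 130 * (lamE : ℝ) / lam * Real.log n = lamE / lam * (130 * Real.log n) := by ring
  rw [h3, h4]
  gcongr
  linarith

theorem rpow_le_mean_isolated {n : ℕ} {ε p : ℝ} (hε : 0 < ε) (hn : 1 ≤ n)
    (hp0 : 0 ≤ p) (hp2 : p ≤ 1 / 2) (hnp : n * p ≤ (1 - ε) * Real.log n)
    (hsq : 2 * (Real.log n ^ 2 / n) ≤ 1) :
    Real.exp (-1) * (n : ℝ) ^ ε ≤ n * (1 - p) ^ (n - 1) := by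
  have hn0 : (0 : ℝ) < n := by exact_mod_cast hn
  have hlog : 0 ≤ Real.log n := Real.log_nonneg (by exact_mod_cast hn)
  have hq : (0 : ℝ) < 1 - p := by linarith
  -- For 0 ≤ p ≤ 1/2, (1 - p)(1 + p + 2p²) = 1 + p²(1 - 2p) ≥ 1. The quadratic error, multiplied by
  -- n, is at most 1 by `hsq`, which costs the factor e⁻¹.
  have h1 : Real.exp (-(p + 2 * p ^ 2)) ≤ 1 - p := by
    rw [Real.exp_neg, inv_le_comm₀ (Real.exp_pos _) hq]
    refine le_trans ?_ (Real.add_one_le_exp _)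
    rw [inv_le_iff_one_le_mul₀ hq]
    nlinarith [mul_nonneg (sq_nonneg p) (by linarith : 0 ≤ 1 / 2 - p)]
  have h2 : n * (p + 2 * p ^ 2) ≤ (1 - ε) * Real.log n + 1 := by
    have h3 : n * p ≤ Real.log n := by nlinarith
    have h4 : n * p ^ 2 ≤ Real.log n ^ 2 / n := by
      rw [le_div_iff₀ hn0]
      calc n * p ^ 2 * n = (n * p) ^ 2 := by ring
        _ ≤ _ := pow_le_pow_left₀ (by positivity) h3 2
    linarith
  calc Real.exp (-1) * (n : ℝ) ^ ε = n * Real.exp (-((1 - ε) * Real.log n + 1)) := by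
        rw [Real.rpow_def_of_pos hn0, ← Real.exp_add]
        nth_rewrite 2 [← Real.exp_log hn0]
        rw [← Real.exp_add]
        congr 1; ring
    _ ≤ n * Real.exp (n * -(p + 2 * p ^ 2)) := by gcongr; linarith
    _ ≤ n * (1 - p) ^ n := by
        rw [Real.exp_nat_mul]
        gcongr
    _ ≤ n * (1 - p) ^ (n - 1) := by
        gcongr ?_ * ?_
        exact pow_le_pow_of_le_one hq.le (by linarith) (Nat.sub_le n 1)

/-- Below the connectivity threshold the isolated vertices make the average version age large. -/
theorem aas_rpow_le_averageVersionAge (hlamE : 0 < lamE) (hlam : 0 < lam) {ε : ℝ} (hε : 0 < ε)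
    {p : ℕ → unitInterval}
    (hp : ∀ᶠ n : ℕ in atTop, n * (p n : ℝ) ≤ (1 - ε) * Real.log n) :
    AAS p (fun n G => lamE / lam * (Real.exp (-1) / 2) * (n : ℝ) ^ ε ≤
      averageVersionAge lamE lam G) := by
  have hlogn : Tendsto (fun n : ℕ => Real.log n / n) atTop (𝓝 0) := by
    have := (Real.isLittleO_log_id_atTop.tendsto_div_nhds_zero).comp
      (tendsto_natCast_atTop_atTop (R := ℝ))
    simpa [Function.comp_def] using this
  have hlogsq : Tendsto (fun n : ℕ => 2 * (Real.log n ^ 2 / n)) atTop (𝓝 0) := by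
    have := ((Real.isLittleO_pow_log_id_atTop (n := 2)).tendsto_div_nhds_zero).comp
      (tendsto_natCast_atTop_atTop (R := ℝ))
    simpa [Function.comp_def] using this.const_mul 2
  -- The two Chebyshev terms: 4/m with m ≥ e⁻¹ n^ε, and 4p/(1 - p) with p ≤ log n/n and p ≤ 1/2.
  have hb : Tendsto (fun n : ℕ => 4 * Real.exp 1 * (n : ℝ) ^ (-ε) + 8 * (Real.log n / n)) atTop
      (𝓝 0) := by
    have := (tendsto_rpow_neg_atTop hε).comp (tendsto_natCast_atTop_atTop (R := ℝ))
    simpa using (this.const_mul (4 * Real.exp 1)).add (hlogn.const_mul 8)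
  refine aas_of_tendsto hb ?_
  filter_upwards [hp, hlogn.eventually_le_const (show (0 : ℝ) < 1 / 2 by norm_num),
    hlogsq.eventually_le_const zero_lt_one, eventually_ge_atTop 1] with n hnp hhalf hsq hn
  have hn0 : (0 : ℝ) < n := by exact_mod_cast hn
  have hlog : 0 ≤ Real.log n := Real.log_nonneg (by exact_mod_cast hn)
  have hp0 := (p n).2.1
  have hpl : (p n : ℝ) ≤ Real.log n / n := by
    rw [le_div_iff₀ hn0]
    nlinarith
  have hp2 : (p n : ℝ) ≤ 1 / 2 := hpl.trans hhalf
  have hm := rpow_le_mean_isolated hε hn hp0 hp2 hnp hsq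
  have : Nonempty (Fin n) := ⟨⟨0, hn⟩⟩
  set m : ℝ := n * (1 - p n : ℝ) ^ (n - 1) with hm_def
  have hr0 : (0 : ℝ) < (n : ℝ) ^ ε := Real.rpow_pos_of_pos hn0 ε
  have hbound := measureReal_isolatedCount_le (V := Fin n) (p n) (by linarith) (m := m)
    (by rw [Fintype.card_fin])
  have h1 : 4 / m ≤ 4 * Real.exp 1 * (n : ℝ) ^ (-ε) := by
    calc 4 / m ≤ 4 / (Real.exp (-1) * (n : ℝ) ^ ε) := by gcongr
      _ = _ := by
        rw [Real.exp_neg, Real.rpow_neg hn0.le]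
        field_simp
  have h2 : (p n : ℝ) / (1 - p n) ≤ 2 * (Real.log n / n) := by
    rw [div_le_iff₀ (by linarith)]
    nlinarith
  refine (measureReal_mono ?_).trans (hbound.trans (by linarith))
  intro G hG
  simp only [Set.mem_compl_iff, Set.mem_ofPred_eq, not_le] at hG ⊢
  have hiso := mul_card_isolated_le_averageVersionAge (lamE := lamE) (lam := lam) G hlamE hlam hn
  have hlt := hiso.trans_lt hG
  have hr : (0 : ℝ) < lamE / lam := div_pos hlamE hlam
  rw [mul_assoc] at hlt
  have := lt_of_mul_lt_mul_left hlt hr.le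
  rw [isolatedCount]
  linarith

end Asymptotics

end Gossip

end

theorem theorem3 (lamE lam : ℝ≥0) (hlamE : 0 < lamE) (hlam : 0 < lam) :
    -- the limits that define the version ages exist and are finite
    (∀ (n : ℕ) (G : SimpleGraph (Fin n)) (j : Fin n),
      Tendsto (Gossip.meanAge lamE lam G j) atTop
        (𝓝 (ENNReal.ofReal (Gossip.versionAge lamE lam G j)))) ∧
    -- isolated vertices have linear version age
    (∀ (n : ℕ) (G : SimpleGraph (Fin n)) (j : Fin n), (∀ i, ¬ G.Adj j i) →
      Gossip.versionAge lamE lam G j = (lamE : ℝ) * n / lam) ∧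
    -- below the threshold
    (∀ ε : ℝ, 0 < ε → ε ≤ 1 → ∃ c : ℝ, 0 < c ∧
      ∀ p : ℕ → unitInterval,
        (∀ᶠ n : ℕ in atTop, (p n : ℝ) = (1 - ε) * Real.log n / n) →
        Gossip.AAS p (fun n G =>
          c * (n : ℝ) ^ ε ≤ Gossip.averageVersionAge lamE lam G)) ∧
    -- above the threshold
    (∀ ε : ℝ, 0 < ε → ∃ c C : ℝ, 0 < c ∧ 0 < C ∧
      ∀ p : ℕ → unitInterval,
        (∀ᶠ n : ℕ in atTop, (p n : ℝ) = (100 + ε) * Real.log n / n) →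
        Gossip.AAS p (fun n G =>
          c * Real.log n ≤ Gossip.averageVersionAge lamE lam G ∧
          Gossip.averageVersionAge lamE lam G ≤ C * Real.log n)) ∧
    -- existence of a threshold
    (∃ α cstar : ℝ, 0 < α ∧ 1 ≤ cstar ∧ cstar ≤ 100 ∧
      Gossip.IsThreshold (fun n => cstar * Real.log n / n)
        (fun n G => Gossip.averageVersionAge lamE lam G < α * Real.log n)) := by
  have hl : (0 : ℝ) < lam := hlam
  have hlE : (0 : ℝ) < lamE := hlamE
  refine ⟨fun n G j => Gossip.tendsto_meanAge_versionAge G hlamE hlam j,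
    fun n G j hj => Gossip.versionAge_of_isolated G hlamE hlam hj,
    fun ε hε _ => ⟨lamE / lam * (Real.exp (-1) / 2), by positivity, fun p hp =>
      Gossip.aas_rpow_le_averageVersionAge hlamE hlam hε ?_⟩,
    fun ε hε => ⟨lamE / (lam * (64 + 1)), 130 * lamE / lam, by positivity, by positivity,
      fun p hp => Gossip.aas_averageVersionAge_log hlamE hlam ?_⟩,
    -- The summand 1 in α makes the upper bound strict. A threshold is insensitive to constant
    -- factors, so c* = 1 serves.
    130 * lamE / lam + 1, 1, by positivity, le_rfl, by norm_num, fun p => ⟨fun hp => ?_,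
      fun hp => ?_⟩⟩
  · filter_upwards [hp, eventually_gt_atTop 0] with n hn hn0
    have : (0 : ℝ) < n := by exact_mod_cast hn0
    rw [hn]
    field_simp
    exact le_rfl
  · filter_upwards [hp, eventually_gt_atTop 0] with n hn hn0
    have : (0 : ℝ) < n := by exact_mod_cast hn0
    have hlog : 0 ≤ Real.log n := Real.log_nonneg (by exact_mod_cast hn0)
    rw [hn, mul_div_cancel₀ _ this.ne']
    nlinarith
  · have hp2 : ∀ᶠ n : ℕ in atTop, n * (p n : ℝ) ≤ (1 - 1 / 2) * Real.log n := by
      filter_upwards [hp.eventually_le_const (show (0 : ℝ) < 1 / 2 by norm_num),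
        eventually_gt_atTop 0, Gossip.tendsto_natCast_log.eventually_gt_atTop 0] with n hn hn0 hlog
      have : (0 : ℝ) < n := by exact_mod_cast hn0
      rw [one_mul, div_le_iff₀ (by positivity), ← mul_div_assoc, le_div_iff₀ this] at hn
      linarith
    refine (Gossip.aas_rpow_le_averageVersionAge hlamE hlam one_half_pos
      hp2).tendsto_zero ?_
    -- Below the threshold ε = 1/2 is used: the lower bound of order √n eventually exceeds α log n.
    -- This constant is the ratio of the one in the lower bound to α.
    have hc : 0 < lamE / lam * (Real.exp (-1) / 2) / (130 * lamE / lam + 1) := by positivity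
    have ho := ((isLittleO_log_rpow_atTop (one_half_pos (α := ℝ))).comp_tendsto
      (tendsto_natCast_atTop_atTop (R := ℝ))).bound hc
    filter_upwards [ho] with n hn G hG
    rw [not_lt]
    refine le_trans ?_ hG
    simp only [Function.comp_apply, Real.norm_eq_abs] at hn
    rw [abs_of_nonneg (by positivity : (0 : ℝ) ≤ (n : ℝ) ^ (1 / 2 : ℝ))] at hn
    have h2 := (le_abs_self _).trans hn
    have h3 := mul_le_mul_of_nonneg_left h2
      (by positivity : (0 : ℝ) ≤ 130 * lamE / lam + 1)
    refine h3.trans (le_of_eq ?_)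
    field_simp
  · have hp2 : ∀ᶠ n : ℕ in atTop, 100 * Real.log n ≤ n * (p n : ℝ) := by
      filter_upwards [hp.eventually_ge_atTop 100, eventually_gt_atTop 0,
        Gossip.tendsto_natCast_log.eventually_gt_atTop 0] with n hn hn0 hlog
      have : (0 : ℝ) < n := by exact_mod_cast hn0
      rw [one_mul, le_div_iff₀ (by positivity), ← mul_div_assoc, div_le_iff₀ this] at hn
      linarith
    refine (Gossip.aas_averageVersionAge_log hlamE hlam hp2).mono ?_
    filter_upwards [Gossip.tendsto_natCast_log.eventually_gt_atTop 0] with n hlog G hG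
    refine hG.2.trans_lt ?_
    linarith
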